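/- Let $\mathbb F_2$ be the free group on two generators $a,b$, with word length $\ell$, and write $[x,y]=xyx^{-1}y^{-1}$. For a group $G$, $z\in\mathbb F_2$ and $u,v\in G$, let $z(u,v)\in G$ be the image of $z$ under the homomorphism $\mathbb F_2\to G$ with $a\mapsto u$, $b\mapsto v$. Define $a_n,b_n\in\mathbb F_2$ by $a_0=a$, $b_0=b$, $a_{n+1}=[b_n^{-1},a_n]$, $b_{n+1}=[a_n,b_n]$. A sequence $(w_n)_{n\ge 0}$ of non-trivial elements of $\mathbb F_2$ is called an almost law for a topological group $G$ if for every neighbourhood $V$ of the identity of $G$ there is $m$ such that $w_n(u,v)\in V$ for all $n\ge m$ and all $u,v\in G$. For $k\in\mathbb N$ and $z\in\mathbb F_2$ put $$L_k(z)=\max\{\|1_k-z(u,v)\| : u,v\in \mathrm{SU}(k)\},$$ where $\|\cdot\|$ is the operator norm on complex $k\times k$ matrices (for the Euclidean norm on $\mathbb C^k$). **Theorem.** Let $k\in\mathbb N$. Then $L_k([x,y])\le 2L_k(x)L_k(y)$ for all $x,y\in\mathbb F_2$. Moreover, there exist $w,v\in\mathbb F_2$ freely generating a free subgroup of rank two such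 that the sequence $w_n:=a_n(w,v)$ is an almost law for $\mathrm{SU}(k)$ and, for some constant $C>0$, $$L_k(w_n)\le\exp\left(-C\cdot\ell(w_n)^{\delta}\right)\quad\text{for all } n\ge 0,\qquad \delta=\frac{\log_2(1+\sqrt2)}{\log_2(3+\sqrt{17})-1}=0.6939\ldots$$ -/

import Mathlib

open scoped Topology commutatorElement

/-- The free group on two generators. -/
abbrev F₂ : Type := FreeGroup (Fin 2)

/-- The special unitary group `SU(k)` (with the topology of entrywise convergence). -/
abbrev SU (k : ℕ) : Type := Matrix.specialUnitaryGroup (Fin k) ℂ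

/-- The words `(aₙ, bₙ)`: `a₀ = a`, `b₀ = b`, `aₙ₊₁ = [bₙ⁻¹, aₙ]`, `bₙ₊₁ = [aₙ, bₙ]`, where
`a, b` are the two generators and `[x, y] = x y x⁻¹ y⁻¹`. -/
def abWord : ℕ → F₂ × F₂
  | 0 => (FreeGroup.of 0, FreeGroup.of 1)
  | n + 1 => (⁅(abWord n).2⁻¹, (abWord n).1⁆, ⁅(abWord n).1, (abWord n).2⁆)

/-- The value `w(u, v)` of a word at a pair of elements of a group: substitute `u` for the first
generator and `v` for the second one. -/
def wordMap {G : Type*} [Group G] (w : F₂) (u v : G) : G :=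
  FreeGroup.lift ![u, v] w

/-- A sequence of nontrivial words is an almost law for a topological group `G` if, for every
neighbourhood `V` of the identity, all but finitely many of the word maps send `G × G` into `V`. -/
def IsAlmostLaw (G : Type*) [Group G] [TopologicalSpace G] (w : ℕ → F₂) : Prop :=
  (∀ n, w n ≠ 1) ∧ ∀ V ∈ 𝓝 (1 : G), ∃ m, ∀ n ≥ m, ∀ u v : G, wordMap (w n) u v ∈ V

section

open scoped Matrix.Norms.L2Operator

/-- `L_k(w)`, the largest operator norm distance from `w(u, v)` to the identity matrix, for
`u, v ∈ SU(k)`. The supremum is attained, see `isGreatest_maxDist`. -/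
noncomputable def maxDist (k : ℕ) (w : F₂) : ℝ :=
  ⨆ p : SU k × SU k, ‖(1 : Matrix (Fin k) (Fin k) ℂ) - (wordMap w p.1 p.2 : SU k)‖

theorem continuous_wordMap {G : Type*} [Group G] [TopologicalSpace G] [ContinuousMul G]
    [ContinuousInv G] (w : F₂) : Continuous fun p : G × G => wordMap w p.1 p.2 := by
  unfold wordMap
  induction w using FreeGroup.induction_on with
  | C1 => simpa using continuous_const
  | of i => fin_cases i <;> simp <;> fun_prop
  | inv_of i h => simp only [map_inv]; exact h.inv
  | mul x y hx hy => simp only [map_mul]; exact hx.mul hy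

theorem compactSpace_SU (k : ℕ) : CompactSpace (SU k) := by
  refine (isCompact_iff_compactSpace
    (s := (Matrix.specialUnitaryGroup (Fin k) ℂ : Set (Matrix (Fin k) (Fin k) ℂ)))).mp ?_
  refine Metric.isCompact_of_isClosed_isBounded ?_ ?_
  · have : (Matrix.specialUnitaryGroup (Fin k) ℂ : Set (Matrix (Fin k) (Fin k) ℂ)) =
        {A | A * star A = 1} ∩ {A | A.det = 1} := by
      ext A
      simp [Matrix.mem_specialUnitaryGroup_iff, Matrix.mem_unitaryGroup_iff]
    rw [this]
    exact (isClosed_eq (by fun_prop) continuous_const).inter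
      (isClosed_eq (Continuous.matrix_det continuous_id) continuous_const)
  · refine (Metric.isBounded_closedBall (x := (0 : Matrix (Fin k) (Fin k) ℂ)) (r := 1)).subset ?_
    intro A hA
    have hA' : A ∈ unitary (Matrix (Fin k) (Fin k) ℂ) := hA.1
    rw [mem_closedBall_zero_iff]
    rcases subsingleton_or_nontrivial (Matrix (Fin k) (Fin k) ℂ) with h | h
    · rw [Subsingleton.elim A 0]; simp
    · exact (CStarRing.norm_of_mem_unitary hA').le

theorem isGreatest_maxDist (k : ℕ) (w : F₂) :
    IsGreatest {r : ℝ | ∃ u v : SU k,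
      r = ‖(1 : Matrix (Fin k) (Fin k) ℂ) - (wordMap w u v : SU k)‖} (maxDist k w) := by
  have := compactSpace_SU k
  have : ContinuousInv (SU k) :=
    ⟨Continuous.subtype_mk (f := fun A : SU k => star (A : Matrix (Fin k) (Fin k) ℂ))
      (continuous_star.comp continuous_subtype_val) fun A => (star A).2⟩
  have hc : Continuous fun p : SU k × SU k =>
      ‖(1 : Matrix (Fin k) (Fin k) ℂ) - (wordMap w p.1 p.2 : SU k)‖ :=
    (continuous_const.sub (continuous_subtype_val.comp (continuous_wordMap w))).norm
  have hcomp := isCompact_range hc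
  have hg := hcomp.isGreatest_sSup (Set.range_nonempty _)
  refine ⟨?_, ?_⟩
  · obtain ⟨p, hp⟩ := hg.1
    exact ⟨p.1, p.2, hp.symm⟩
  · rintro r ⟨u, v, rfl⟩
    exact hg.2 ⟨(u, v), rfl⟩

end

/-! Write d(g) = 2‖1 - g‖. Unitarity and hg - gh = (1-h)(1-g) - (1-g)(1-h) give d([g,h]) ≤ d(g)d(h).
Since [b⁻¹,a] is a conjugate of [a,b], one has a_{n+2} = [b_{n+1}⁻¹, [b_n⁻¹, b_{n+1}]], so two steps
cost d(b_{n+1})² d(b_n): exponents grow by the root 1+√2 of t² = 2t+1 (`two_mul_oneDist_abWord_le`).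
Cancellation in a_n b_n keeps lengths within O(rⁿ), r = (3+√17)/2 (`exists_norm_abWord_le`), and δ =
log_r(1+√2).

The recursion must start near the identity. `exists_word_small` supplies a nontrivial w uniformly
close to 1: some bounded power of u is always close to 1, and commutators combine words treating
each exponent. A conjugate of w not commuting with w serves as v; the two are then free generators
(`FreeGroup.lift_injective_of_not_commute`). -/

section FreeGroups

/-! ### Commutation and freeness in free groups -/

theorem not_commute_swap_fin_three :
    ¬Commute (Equiv.swap (0 : Fin 3) 1) (Equiv.swap (1 : Fin 3) 2) := by
  unfold Commute SemiconjBy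
  decide

theorem FreeGroup.not_commute_of {α : Type*} {i j : α} (hij : i ≠ j) :
    ¬Commute (FreeGroup.of i) (FreeGroup.of j) := by
  classical
  intro h
  have := h.map (FreeGroup.lift fun l => if l = i then Equiv.swap (0 : Fin 3) 1 else Equiv.swap 1 2)
  simp only [FreeGroup.lift_apply_of, if_true, if_neg hij.symm] at this
  exact not_commute_swap_fin_three this

theorem FreeGroup.exists_forall_mem_zpowers {α : Type*} [Subsingleton α] :
    ∃ z : FreeGroup α, ∀ x, x ∈ Subgroup.zpowers z := by
  rcases isEmpty_or_nonempty α with h | ⟨⟨i⟩⟩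
  · exact ⟨1, fun x => by rw [Subsingleton.elim x 1]; exact one_mem _⟩
  · refine ⟨FreeGroup.of i, fun x => ?_⟩
    have hx : x ∈ Subgroup.closure (Set.range (FreeGroup.of : α → FreeGroup α)) := by
      rw [FreeGroup.closure_range_of]; trivial
    refine (Subgroup.closure_le _).2 ?_ hx
    rintro _ ⟨j, rfl⟩
    rw [Subsingleton.elim j i]
    exact Subgroup.mem_zpowers _

/-- A commutative free group is cyclic. -/
theorem IsFreeGroup.exists_forall_mem_zpowers {H : Type*} [Group H] [IsFreeGroup H]
    (h : ∀ x y : H, Commute x y) : ∃ z : H, ∀ x, x ∈ Subgroup.zpowers z := by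
  let e := IsFreeGroup.toFreeGroup H
  have : Subsingleton (IsFreeGroup.Generators H) := ⟨fun i j => by
    by_contra hij
    refine FreeGroup.not_commute_of hij ?_
    simpa using (h (e.symm (.of i)) (e.symm (.of j))).map e⟩
  obtain ⟨z, hz⟩ := FreeGroup.exists_forall_mem_zpowers (α := IsFreeGroup.Generators H)
  refine ⟨e.symm z, fun x => ?_⟩
  obtain ⟨n, hn⟩ := hz (e x)
  exact ⟨n, by simpa using congrArg e.symm hn⟩

/-- The subgroup generated by x and y is abelian, and free by Nielsen–Schreier, hence cyclic. -/
theorem FreeGroup.exists_mem_zpowers_of_commute {α : Type*} {x y : FreeGroup α}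
    (h : Commute x y) : ∃ z, x ∈ Subgroup.zpowers z ∧ y ∈ Subgroup.zpowers z := by
  let H := Subgroup.closure ({x, y} : Set (FreeGroup α))
  have hc : ∀ a b : H, Commute a b := by
    have hcomm := Subgroup.isMulCommutative_closure (k := ({x, y} : Set (FreeGroup α))) (by
      rintro a (rfl | rfl) b (rfl | rfl)
      exacts [rfl, h, h.symm, rfl])
    exact fun a b => hcomm.is_comm.comm a b
  obtain ⟨z, hz⟩ := IsFreeGroup.exists_forall_mem_zpowers hc
  have key : ∀ a (ha : a ∈ H), a ∈ Subgroup.zpowers (z : FreeGroup α) := fun a ha => by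
    obtain ⟨n, hn⟩ := hz ⟨a, ha⟩
    exact ⟨n, by simpa using congrArg Subtype.val hn⟩
  exact ⟨z, key x (Subgroup.subset_closure (by simp)), key y (Subgroup.subset_closure (by simp))⟩

/-- Free groups are commutative transitive. -/
theorem FreeGroup.commute_of_commute {α : Type*} {x a b : FreeGroup α} (hx : x ≠ 1)
    (ha : Commute x a) (hb : Commute x b) : Commute a b := by
  obtain ⟨z, ⟨p, hp⟩, ⟨q, hq⟩⟩ := FreeGroup.exists_mem_zpowers_of_commute ha
  have hp' : z ^ p = x := hp
  have hq' : z ^ q = a := hq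
  have hp0 : p ≠ 0 := by
    rintro rfl
    exact hx (by simpa using hp'.symm)
  -- So b commutes with a power of a; uniqueness of roots then makes b commute with a itself.
  have hap : a ^ p = x ^ q := by rw [← hp', ← hq', ← zpow_mul, ← zpow_mul, mul_comm]
  have hc : Commute b (a ^ p) := hap ▸ (hb.symm.zpow_right q)
  have h1 : (b * a * b⁻¹) ^ p = a ^ p := by
    rw [conj_zpow, hc.eq, mul_inv_cancel_right]
  have h2 : b * a * b⁻¹ = a := zpow_left_injective hp0 h1
  have h3 : b * a = a * b := by
    rw [mul_inv_eq_iff_eq_mul] at h2; exact h2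
  exact h3.symm

/-- Free groups are residually finite. -/
theorem FreeGroup.exists_perm_ne_one {α : Type*} {z : FreeGroup α} (hz : z ≠ 1) :
    ∃ (S : Finset (FreeGroup α)) (ρ : FreeGroup α →* Equiv.Perm S), ρ z ≠ 1 := by
  classical
  obtain ⟨L, rfl⟩ : ∃ L, FreeGroup.mk L = z := Quot.exists_rep z
  -- On the suffixes of the word, left multiplication by a generator is a partial injection;
  -- extended to permutations, these let the word send 1 to itself, z ≠ 1.
  let S : Finset (FreeGroup α) := (L.tails.map FreeGroup.mk).toFinset
  have memS : ∀ L' : List (α × Bool), L' <:+ L → FreeGroup.mk L' ∈ S := fun L' h => by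
    simp only [S, List.mem_toFinset, List.mem_map, List.mem_tails]
    exact ⟨L', h, rfl⟩
  let e : ∀ i : α, {s : S // FreeGroup.of i * (s : FreeGroup α) ∈ S} ≃
      {s : S // (FreeGroup.of i)⁻¹ * (s : FreeGroup α) ∈ S} := fun i =>
    { toFun := fun s => ⟨⟨FreeGroup.of i * (s : S), s.2⟩, by simp⟩
      invFun := fun s => ⟨⟨(FreeGroup.of i)⁻¹ * (s : S), s.2⟩, by simp⟩
      left_inv := fun s => by ext; simp
      right_inv := fun s => by ext; simp }
  let ρ : FreeGroup α →* Equiv.Perm S := FreeGroup.lift fun i => (e i).extendSubtype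
  have hρ : ∀ (i : α) (s t : S), (t : FreeGroup α) = FreeGroup.of i * s →
      ρ (FreeGroup.of i) s = t := by
    intro i s t hst
    have hs : FreeGroup.of i * (s : FreeGroup α) ∈ S := hst ▸ t.2
    have : ρ (FreeGroup.of i) s = (e i ⟨s, hs⟩ : S) := by
      simp only [ρ, FreeGroup.lift_apply_of]
      exact (e i).extendSubtype_apply_of_mem s hs
    rw [this]
    ext
    exact hst.symm
  have key : ∀ L' : List (α × Bool), L' <:+ L →
      (ρ (FreeGroup.mk L') ⟨1, memS [] List.nil_suffix⟩ : FreeGroup α) = FreeGroup.mk L' := by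
    intro L'
    induction L' with
    | nil => intro h; rw [← FreeGroup.one_eq_mk, _root_.map_one]; rfl
    | cons l T ih =>
      intro h
      obtain ⟨i, c⟩ := l
      have hT : T <:+ L := (List.suffix_cons _ _).trans h
      have hr : ρ (FreeGroup.mk T) ⟨1, memS [] List.nil_suffix⟩ = ⟨FreeGroup.mk T, memS T hT⟩ :=
        Subtype.ext (ih hT)
      cases c with
      | true =>
        have hmul : FreeGroup.mk ((i, true) :: T) = FreeGroup.of i * FreeGroup.mk T := rfl
        have h2 := hρ i ⟨_, memS T hT⟩ ⟨_, memS _ h⟩ hmul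
        rw [hmul, _root_.map_mul, Equiv.Perm.mul_apply, hr, h2, ← hmul]
      | false =>
        have hmul : FreeGroup.mk ((i, false) :: T) = (FreeGroup.of i)⁻¹ * FreeGroup.mk T := rfl
        have h2 := hρ i ⟨_, memS _ h⟩ ⟨_, memS T hT⟩ (by simp [hmul])
        rw [hmul, _root_.map_mul, Equiv.Perm.mul_apply, hr, ← h2, _root_.map_inv,
          ← Equiv.Perm.mul_apply, inv_mul_cancel, Equiv.Perm.one_apply, ← hmul]
  refine ⟨S, ρ, fun h => hz ?_⟩
  have := key L (List.suffix_refl L)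
  rw [h] at this
  exact this.symm

/-- Free groups of finite rank are Hopfian. -/
theorem FreeGroup.injective_of_surjective {α : Type*} [Finite α] (f : FreeGroup α →* FreeGroup α)
    (hf : Function.Surjective f) : Function.Injective f := by
  rw [injective_iff_map_eq_one]
  intro z hz
  by_contra hz1
  obtain ⟨S, ρ, hρ⟩ := FreeGroup.exists_perm_ne_one hz1
  -- Precomposition with f on the finite set Hom(F, Perm S) is injective, hence surjective, so ρ
  -- factors through f and kills z.
  let T : (α → Equiv.Perm S) → (α → Equiv.Perm S) := fun t i => FreeGroup.lift t (f (.of i))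
  have hT : ∀ t, FreeGroup.lift (T t) = (FreeGroup.lift t).comp f := fun t => by
    ext i; simp [T]
  have hinj : Function.Injective T := fun s t hst => by
    have h : (FreeGroup.lift s).comp f = (FreeGroup.lift t).comp f := by rw [← hT, ← hT, hst]
    exact FreeGroup.lift.injective (MonoidHom.cancel_right hf |>.1 h)
  obtain ⟨t, ht⟩ := Finite.surjective_of_injective hinj (fun i => ρ (.of i))
  have h1 : FreeGroup.lift (T t) = ρ := by ext i; simp [ht]
  apply hρ
  rw [← h1, hT, MonoidHom.comp_apply, hz]
  exact _root_.map_one _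

/-- Counts homomorphisms to ℤ/2: precomposition with a surjection is injective. -/
theorem FreeGroup.natCard_le_of_surjective {α β : Type*} [Finite α]
    (f : FreeGroup α →* FreeGroup β) (hf : Function.Surjective f) :
    Finite β ∧ Nat.card β ≤ Nat.card α := by
  classical
  let T : (β → Multiplicative (ZMod 2)) → (α → Multiplicative (ZMod 2)) :=
    fun t i => FreeGroup.lift t (f (.of i))
  have hT : ∀ t, FreeGroup.lift (T t) = (FreeGroup.lift t).comp f := fun t => by
    ext i; simp [T]
  have hinj : Function.Injective T := fun s t hst => by
    have h : (FreeGroup.lift s).comp f = (FreeGroup.lift t).comp f := by rw [← hT, ← hT, hst]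
    exact FreeGroup.lift.injective (MonoidHom.cancel_right hf |>.1 h)
  have hfin : Finite (β → Multiplicative (ZMod 2)) := Finite.of_injective T hinj
  have hβ : Finite β := Finite.of_injective
    (fun b : β => (Pi.mulSingle b (Multiplicative.ofAdd 1) : β → Multiplicative (ZMod 2)))
    fun b c hbc => by
      by_contra hne
      have := congrFun hbc b
      simp only [Pi.mulSingle_eq_same, Pi.mulSingle_eq_of_ne hne] at this
      exact absurd this (by decide)
  refine ⟨hβ, ?_⟩
  have := Nat.card_le_card_of_injective T hinj
  rw [Nat.card_fun, Nat.card_fun] at this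
  have h2 : Nat.card (Multiplicative (ZMod 2)) = 2 := by simp
  rw [h2] at this
  exact (Nat.pow_le_pow_iff_right (by norm_num)).1 this

/-- Two elements of a free group that do not commute freely generate a free subgroup. -/
theorem FreeGroup.lift_injective_of_not_commute {α : Type*} {x y : FreeGroup α}
    (h : ¬Commute x y) : Function.Injective (FreeGroup.lift ![x, y]) := by
  let f : FreeGroup (Fin 2) →* FreeGroup α := FreeGroup.lift ![x, y]
  -- The range is free of rank at most 2, and not cyclic, so of rank exactly 2; the Hopf property
  -- makes f injective.
  let e := IsFreeGroup.toFreeGroup f.range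
  let g : FreeGroup (Fin 2) →* FreeGroup (IsFreeGroup.Generators f.range) :=
    e.toMonoidHom.comp f.rangeRestrict
  have hg : Function.Surjective g := e.surjective.comp f.rangeRestrict_surjective
  obtain ⟨hfin, hcard⟩ := FreeGroup.natCard_le_of_surjective g hg
  have hcard' : Nat.card (IsFreeGroup.Generators f.range) = Nat.card (Fin 2) := by
    refine le_antisymm hcard ?_
    by_contra hlt
    rw [Nat.card_fin, not_le] at hlt
    have : Subsingleton (IsFreeGroup.Generators f.range) := by
      rw [← Finite.card_le_one_iff_subsingleton]; omega
    obtain ⟨z, hz⟩ := FreeGroup.exists_forall_mem_zpowers (α := IsFreeGroup.Generators f.range)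
    have hcomm : Commute (g (.of 0)) (g (.of 1)) := by
      obtain ⟨m, hm⟩ := hz (g (.of 0))
      obtain ⟨n, hn⟩ := hz (g (.of 1))
      rw [← hm, ← hn]
      exact (Commute.refl z).zpow_zpow m n
    have h1 := (hcomm.map e.symm).map f.range.subtype
    apply h
    simpa [g, f] using h1
  obtain ⟨c⟩ : Nonempty (IsFreeGroup.Generators f.range ≃ Fin 2) :=
    ⟨(Finite.card_eq.1 hcard').some⟩
  let d := FreeGroup.freeGroupCongr c
  have hinj := FreeGroup.injective_of_surjective (d.toMonoidHom.comp g) (d.surjective.comp hg)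
  intro a b hab
  apply hinj
  have : f.rangeRestrict a = f.rangeRestrict b := Subtype.ext hab
  simp [g, this]

/-- Otherwise transitivity makes y commute with all its conjugates, contradicting freeness of g, y
for any g not commuting with y. -/
theorem FreeGroup.exists_not_commute_conj {x y : FreeGroup (Fin 2)} (hx : x ≠ 1) (hy : y ≠ 1) :
    ∃ g, ¬Commute x (g * y * g⁻¹) := by
  by_contra! hcon
  obtain ⟨g, hg⟩ : ∃ g, ¬Commute g y := by
    by_contra! hall
    exact FreeGroup.not_commute_of (zero_ne_one (α := Fin 2))
      (FreeGroup.commute_of_commute hy (hall _).symm (hall _).symm)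
  have h1 : Commute y (g * y * g⁻¹) :=
    FreeGroup.commute_of_commute hx (by simpa using hcon 1) (hcon g)
  have hinj := FreeGroup.lift_injective_of_not_commute hg
  have h2 : (FreeGroup.of 1 : FreeGroup (Fin 2)) * (.of 0 * .of 1 * (.of 0)⁻¹) =
      .of 0 * .of 1 * (.of 0)⁻¹ * .of 1 := hinj (by simpa using h1.eq)
  exact absurd h2 (by decide)

theorem not_commute_abWord_one : ¬Commute (abWord 1).1 (abWord 1).2 := by
  unfold Commute SemiconjBy
  decide

theorem lift_abWord_succ {G : Type*} [Group G] (x y : G) (n : ℕ) :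
    FreeGroup.lift ![x, y] (abWord (n + 1)).1 =
      ⁅(FreeGroup.lift ![x, y] (abWord n).2)⁻¹, FreeGroup.lift ![x, y] (abWord n).1⁆ ∧
    FreeGroup.lift ![x, y] (abWord (n + 1)).2 =
      ⁅FreeGroup.lift ![x, y] (abWord n).1, FreeGroup.lift ![x, y] (abWord n).2⁆ := by
  simp [abWord, map_commutatorElement]

/-- A non-commuting pair is free, so the next pair is the image of (a₁, b₁) under an injective map.
-/
theorem not_commute_abWord (n : ℕ) : ¬Commute (abWord n).1 (abWord n).2 := by
  induction n with
  | zero => exact FreeGroup.not_commute_of (zero_ne_one (α := Fin 2))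
  | succ n ih =>
    intro h
    apply not_commute_abWord_one
    have hinj := FreeGroup.lift_injective_of_not_commute ih
    apply hinj
    rw [map_mul, map_mul, (lift_abWord_succ _ _ 0).1, (lift_abWord_succ _ _ 0).2]
    simpa [abWord] using h.eq

theorem abWord_fst_ne_one (n : ℕ) : (abWord n).1 ≠ 1 := fun h =>
  not_commute_abWord n (h ▸ Commute.one_left _)

end FreeGroups

/-! ### Distance to the identity in SU(k) -/

section UnitaryDistance

open scoped Matrix.Norms.L2Operator

variable {k : ℕ}

/-- The operator norm distance of an element of `SU(k)` to the identity. -/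
noncomputable def oneDist (g : SU k) : ℝ :=
  ‖(1 : Matrix (Fin k) (Fin k) ℂ) - (g : Matrix (Fin k) (Fin k) ℂ)‖

theorem coe_mem_unitary (g : SU k) :
    (g : Matrix (Fin k) (Fin k) ℂ) ∈ unitary (Matrix (Fin k) (Fin k) ℂ) := g.2.1

theorem norm_mul_SU (A : Matrix (Fin k) (Fin k) ℂ) (g : SU k) :
    ‖A * (g : Matrix (Fin k) (Fin k) ℂ)‖ = ‖A‖ :=
  CStarRing.norm_mul_mem_unitary A (coe_mem_unitary g)

theorem norm_SU_mul (A : Matrix (Fin k) (Fin k) ℂ) (g : SU k) :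
    ‖(g : Matrix (Fin k) (Fin k) ℂ) * A‖ = ‖A‖ :=
  CStarRing.norm_mem_unitary_mul A (coe_mem_unitary g)

theorem oneDist_nonneg (g : SU k) : 0 ≤ oneDist g := norm_nonneg _

theorem norm_sub_SU (g h : SU k) :
    ‖(g : Matrix (Fin k) (Fin k) ℂ) - (h : Matrix (Fin k) (Fin k) ℂ)‖ = oneDist (h * g⁻¹) := by
  rw [← norm_mul_SU _ g⁻¹, sub_mul, oneDist]
  simp only [← Submonoid.coe_mul, mul_inv_cancel, Submonoid.coe_one]

theorem oneDist_inv (g : SU k) : oneDist g⁻¹ = oneDist g := by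
  have h := norm_sub_SU g 1
  rw [one_mul] at h
  rw [← h, norm_sub_rev, oneDist, Submonoid.coe_one]

theorem oneDist_conj (g h : SU k) : oneDist (g * h * g⁻¹) = oneDist h := by
  have : (1 : Matrix (Fin k) (Fin k) ℂ) - ((g * h * g⁻¹ : SU k) : Matrix (Fin k) (Fin k) ℂ) =
      (g : Matrix (Fin k) (Fin k) ℂ) * (1 - (h : Matrix (Fin k) (Fin k) ℂ)) *
        ((g⁻¹ : SU k) : Matrix (Fin k) (Fin k) ℂ) := by
    simp only [mul_sub, sub_mul, mul_one, ← Submonoid.coe_mul, mul_inv_cancel, Submonoid.coe_one]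
  rw [oneDist, this, norm_mul_SU, norm_SU_mul, oneDist]

theorem norm_SU_le_one (g : SU k) : ‖(g : Matrix (Fin k) (Fin k) ℂ)‖ ≤ 1 := by
  rcases subsingleton_or_nontrivial (Matrix (Fin k) (Fin k) ℂ) with h | h
  · rw [Subsingleton.elim (g : Matrix (Fin k) (Fin k) ℂ) 0]; simp
  · exact (CStarRing.norm_of_mem_unitary (coe_mem_unitary g)).le

theorem oneDist_le_two (g : SU k) : oneDist g ≤ 2 := by
  have h1 := norm_SU_le_one (1 : SU k)
  rw [Submonoid.coe_one] at h1
  have h2 := norm_SU_le_one g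
  have := norm_sub_le (1 : Matrix (Fin k) (Fin k) ℂ) (g : Matrix (Fin k) (Fin k) ℂ)
  unfold oneDist
  linarith

theorem oneDist_commutator_le (g h : SU k) : oneDist ⁅g, h⁆ ≤ 2 * oneDist g * oneDist h := by
  have key : ((h * g : SU k) : Matrix (Fin k) (Fin k) ℂ) -
        ((g * h : SU k) : Matrix (Fin k) (Fin k) ℂ)
      = (1 - (h : Matrix (Fin k) (Fin k) ℂ)) * (1 - (g : Matrix (Fin k) (Fin k) ℂ)) -
        (1 - (g : Matrix (Fin k) (Fin k) ℂ)) * (1 - (h : Matrix (Fin k) (Fin k) ℂ)) := by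
    simp only [Submonoid.coe_mul]
    noncomm_ring
  have h1 : ⁅g, h⁆ = (g * h) * (h * g)⁻¹ := by rw [commutatorElement_def]; group
  rw [h1, ← norm_sub_SU, key]
  have e1 := norm_mul_le (1 - (h : Matrix (Fin k) (Fin k) ℂ)) (1 - (g : Matrix (Fin k) (Fin k) ℂ))
  have e2 := norm_mul_le (1 - (g : Matrix (Fin k) (Fin k) ℂ)) (1 - (h : Matrix (Fin k) (Fin k) ℂ))
  refine (norm_sub_le _ _).trans ?_
  unfold oneDist
  linarith

theorem oneDist_commutator_le_left (g h : SU k) : oneDist ⁅g, h⁆ ≤ 4 * oneDist g := by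
  nlinarith [oneDist_commutator_le g h, oneDist_nonneg g, oneDist_le_two h]

theorem oneDist_commutator_le_right (g h : SU k) : oneDist ⁅g, h⁆ ≤ 4 * oneDist h := by
  nlinarith [oneDist_commutator_le g h, oneDist_nonneg h, oneDist_le_two g]

/-- Pigeonhole: two powers of g share a ball of a finite ε/2-cover, whose size bounds the exponent
uniformly in g. -/
theorem exists_pow_oneDist_lt (k : ℕ) {ε : ℝ} (hε : 0 < ε) :
    ∃ M : ℕ, ∀ g : SU k, ∃ m, 1 ≤ m ∧ m ≤ M ∧ oneDist (g ^ m) < ε := by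
  have := compactSpace_SU k
  obtain ⟨t, -, htf, ht⟩ := (isCompact_univ (X := SU k)).finite_cover_balls (half_pos hε)
  refine ⟨htf.toFinset.card, fun g => ?_⟩
  have hc : ∀ n : ℕ, ∃ x ∈ htf.toFinset, dist (g ^ n) x < ε / 2 := fun n => by
    have := ht (Set.mem_univ (g ^ n))
    simpa using this
  choose f hf hfd using hc
  obtain ⟨i, hi, j, hj, hij, hfij⟩ := Finset.exists_ne_map_eq_of_card_lt_of_maps_to
    (s := Finset.range (htf.toFinset.card + 1)) (t := htf.toFinset) (f := f) (by simp)
    (fun n _ => hf n)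
  wlog hlt : i < j generalizing i j
  · exact this j hj i hi hij.symm hfij.symm (by omega)
  refine ⟨j - i, by omega, by have := Finset.mem_range.1 hj; omega, ?_⟩
  have hd : dist (g ^ i) (g ^ j) < ε := by
    have h1 := hfd i
    have h2 := hfd j
    rw [← hfij] at h2
    have := dist_triangle_right (g ^ i) (g ^ j) (f i)
    linarith
  rw [Subtype.dist_eq, dist_eq_norm, norm_sub_SU, ← zpow_natCast, ← zpow_natCast, ← zpow_neg,
    ← zpow_add] at hd
  rw [← zpow_natCast, Nat.cast_sub hlt.le]
  exact hd

end UnitaryDistance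

/-! ### Convergence rate, small words and length growth -/

section Rates

variable {k : ℕ}

/-- With c = [p,q], [q⁻¹,p] = q⁻¹cq = [q⁻¹,c]c, and the right factor c drops out of the outer
commutator with c⁻¹. This gains a second factor of c in the estimate. -/
theorem abWord_step_fst {G : Type*} [Group G] (p q : G) :
    ⁅⁅p, q⁆⁻¹, ⁅q⁻¹, p⁆⁆ = ⁅⁅p, q⁆⁻¹, ⁅q⁻¹, ⁅p, q⁆⁆⁆ := by
  simp only [commutatorElement_def]; group

theorem abWord_step_snd {G : Type*} [Group G] (p q : G) :
    ⁅⁅q⁻¹, p⁆, ⁅p, q⁆⁆ = ⁅p, q⁆ * ⁅⁅p, q⁆⁻¹, ⁅q⁻¹, p⁆⁆ * ⁅p, q⁆⁻¹ := by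
  simp only [commutatorElement_def]; group

theorem two_mul_oneDist_step (p q : SU k) :
    2 * oneDist ⁅⁅p, q⁆⁻¹, ⁅q⁻¹, p⁆⁆ ≤ (2 * oneDist ⁅p, q⁆) ^ 2 * (2 * oneDist q) := by
  rw [abWord_step_fst]
  have h1 := oneDist_commutator_le ⁅p, q⁆⁻¹ ⁅q⁻¹, ⁅p, q⁆⁆
  have h2 := oneDist_commutator_le q⁻¹ ⁅p, q⁆
  rw [oneDist_inv] at h1 h2
  have h3 := mul_le_mul_of_nonneg_left h2 (oneDist_nonneg ⁅p, q⁆)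
  linarith

theorem half_rpow_recurrence (n : ℕ) :
    ((1 / 2 : ℝ) ^ ((1 + √2) ^ (n + 1))) ^ 2 * (1 / 2 : ℝ) ^ ((1 + √2) ^ n) =
      (1 / 2 : ℝ) ^ ((1 + √2) ^ (n + 2)) := by
  have h2 : √2 ^ 2 = 2 := Real.sq_sqrt (by norm_num)
  rw [← Real.rpow_natCast, ← Real.rpow_mul (by norm_num), ← Real.rpow_add (by norm_num)]
  congr 1
  push_cast
  linear_combination (-(1 + √2) ^ n) * h2

theorem two_mul_oneDist_abWord_le {x y : SU k} (hx : oneDist x ≤ 1 / 8) (hy : oneDist y ≤ 1 / 8)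
    (n : ℕ) :
    2 * oneDist (FreeGroup.lift ![x, y] (abWord n).1) ≤ (1 / 2 : ℝ) ^ ((1 + √2) ^ n) ∧
    2 * oneDist (FreeGroup.lift ![x, y] (abWord n).2) ≤ (1 / 2 : ℝ) ^ ((1 + √2) ^ n) := by
  have hs : √2 ≤ 2 := by rw [Real.sqrt_le_left (by norm_num)]; norm_num
  induction n using Nat.twoStepInduction with
  | zero =>
    simp only [abWord, FreeGroup.lift_apply_of, pow_zero, Real.rpow_one]
    simp only [Matrix.cons_val_zero, Matrix.cons_val_one]
    exact ⟨by linarith, by linarith⟩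
  | one =>
    rw [(lift_abWord_succ x y 0).1, (lift_abWord_succ x y 0).2]
    simp only [abWord, FreeGroup.lift_apply_of]
    -- The threshold 1/8 leaves slack at n = 0 so that one commutator reaches 1/16, enough for n =
    -- 1; with 1/4 this would fail.
    have h4 : (1 / 16 : ℝ) ≤ (1 / 2) ^ ((1 + √2) ^ 1) := by
      calc (1 / 16 : ℝ) = (1 / 2 : ℝ) ^ (4 : ℝ) := by norm_num
        _ ≤ _ := Real.rpow_le_rpow_of_exponent_ge (by norm_num) (by norm_num) (by linarith)
    have h5 : oneDist x * oneDist y ≤ 1 / 8 * (1 / 8) :=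
      mul_le_mul hx hy (oneDist_nonneg _) (by norm_num)
    have h1 := oneDist_commutator_le y⁻¹ x
    have h2 := oneDist_commutator_le x y
    rw [oneDist_inv] at h1
    simp only [Matrix.cons_val_zero, Matrix.cons_val_one]
    exact ⟨by linarith, by linarith⟩
  | more n ih0 ih1 =>
    have key : 2 * oneDist (FreeGroup.lift ![x, y] (abWord (n + 2)).1) ≤
        (1 / 2 : ℝ) ^ ((1 + √2) ^ (n + 2)) := by
      rw [(lift_abWord_succ x y (n + 1)).1]
      have h := two_mul_oneDist_step (FreeGroup.lift ![x, y] (abWord n).1)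
        (FreeGroup.lift ![x, y] (abWord n).2)
      rw [← (lift_abWord_succ x y n).1, ← (lift_abWord_succ x y n).2] at h
      rw [← half_rpow_recurrence]
      refine h.trans (mul_le_mul (pow_le_pow_left₀ ?_ ih1.2 2) ih0.2 ?_ (by positivity)) <;>
        exact mul_nonneg (by norm_num) (oneDist_nonneg _)
    refine ⟨key, ?_⟩
    convert key using 2
    rw [(lift_abWord_succ x y (n + 1)).1, (lift_abWord_succ x y (n + 1)).2,
      (lift_abWord_succ x y n).1, (lift_abWord_succ x y n).2, abWord_step_snd, oneDist_conj]

theorem tendsto_half_rpow :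
    Filter.Tendsto (fun n : ℕ => (1 / 2 : ℝ) ^ ((1 + √2) ^ n)) Filter.atTop (𝓝 0) :=
  (tendsto_rpow_atTop_of_base_lt_one (1 / 2) (by norm_num) (by norm_num)).comp
    (tendsto_pow_atTop_atTop_of_one_lt (by
      have : 0 < √2 := Real.sqrt_pos.2 (by norm_num)
      linarith))

theorem wordMap_wordMap {G : Type*} [Group G] (z w v : F₂) (x y : G) :
    wordMap (wordMap z w v) x y = wordMap z (wordMap w x y) (wordMap v x y) := by
  unfold wordMap
  have : (FreeGroup.lift ![x, y]).comp (FreeGroup.lift ![w, v]) =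
      FreeGroup.lift ![FreeGroup.lift ![x, y] w, FreeGroup.lift ![x, y] v] := by
    ext i; fin_cases i <;> simp
  exact DFunLike.congr_fun this z

theorem wordMap_commutator {G : Type*} [Group G] (z w : F₂) (x y : G) :
    wordMap ⁅z, w⁆ x y = ⁅wordMap z x y, wordMap w x y⁆ := map_commutatorElement _ _ _

theorem wordMap_conj {G : Type*} [Group G] (g z : F₂) (x y : G) :
    wordMap (g * z * g⁻¹) x y = wordMap g x y * wordMap z x y * (wordMap g x y)⁻¹ := by
  simp [wordMap]

/-- For each `m ≥ 1` there are nontrivial words that are uniformly close to the identity at all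
`(u, v)` for which `u ^ m` is not far from the identity. -/
theorem exists_word_small_of_pow_small (k : ℕ) {m : ℕ} (hm : 1 ≤ m) {ε : ℝ} (hε : 0 < ε) :
    ∃ c : F₂, c ≠ 1 ∧ ∀ u v : SU k, oneDist (u ^ m) ≤ 1 / 8 → oneDist (wordMap c u v) ≤ ε := by
  have ha : (FreeGroup.of 0 : F₂) ^ m ≠ 1 := by
    rw [Ne, ← FreeGroup.norm_eq_zero, FreeGroup.norm_of_pow]; omega
  obtain ⟨g, hg⟩ := FreeGroup.exists_not_commute_conj ha ha
  obtain ⟨n, hn⟩ := (tendsto_half_rpow.eventually (gt_mem_nhds hε)).exists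
  -- Conjugates are equally far from 1, so both substituted words start within 1/8.
  refine ⟨wordMap (abWord n).1 (.of 0 ^ m) (g * .of 0 ^ m * g⁻¹), fun h => ?_, fun u v huv => ?_⟩
  · refine abWord_fst_ne_one n (FreeGroup.lift_injective_of_not_commute hg ?_)
    rw [map_one]; exact h
  · have hu : wordMap (.of 0 ^ m) u v = u ^ m := by simp [wordMap]
    rw [wordMap_wordMap, wordMap_conj, hu]
    have h := (two_mul_oneDist_abWord_le huv
      ((oneDist_conj (wordMap g u v) (u ^ m)).le.trans huv) n).1
    have h0 := oneDist_nonneg (wordMap (abWord n).1 (u ^ m)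
      (wordMap g u v * u ^ m * (wordMap g u v)⁻¹))
    unfold wordMap at h h0 ⊢
    linarith

theorem exists_word_small (k : ℕ) {ε : ℝ} (hε : 0 < ε) :
    ∃ c : F₂, c ≠ 1 ∧ ∀ u v : SU k, oneDist (wordMap c u v) ≤ ε := by
  obtain ⟨M, hM⟩ := exists_pow_oneDist_lt k (ε := 1 / 8) (by norm_num)
  suffices H : ∀ (N : ℕ) (ε : ℝ), 0 < ε → ∃ c : F₂, c ≠ 1 ∧ ∀ u v : SU k,
      (∃ m, 1 ≤ m ∧ m ≤ N ∧ oneDist (u ^ m) ≤ 1 / 8) → oneDist (wordMap c u v) ≤ ε by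
    obtain ⟨c, hc, h⟩ := H M ε hε
    refine ⟨c, hc, fun u v => h u v ?_⟩
    obtain ⟨m, h1, h2, h3⟩ := hM u
    exact ⟨m, h1, h2, h3.le⟩
  intro N
  induction N with
  | zero => exact fun ε _ => ⟨.of 0, FreeGroup.of_ne_one 0, fun u v ⟨m, h1, h2, _⟩ => by omega⟩
  -- The commutator is small as soon as either entry is; ε/4 absorbs the factor 4, and conjugating d
  -- keeps the commutator nontrivial.
  | succ N ih =>
    intro ε hε
    obtain ⟨c, hc, hcs⟩ := ih (ε / 4) (by positivity)
    obtain ⟨d, hd, hds⟩ := exists_word_small_of_pow_small k (Nat.le_add_left 1 N)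
      (ε := ε / 4) (by positivity)
    obtain ⟨g, hg⟩ := FreeGroup.exists_not_commute_conj hc hd
    refine ⟨⁅c, g * d * g⁻¹⁆, fun h => hg (commutatorElement_eq_one_iff_commute.1 h), ?_⟩
    rintro u v ⟨m, h1, h2, h3⟩
    rw [wordMap_commutator]
    rcases Nat.le_succ_iff.1 h2 with h | rfl
    · have := hcs u v ⟨m, h1, h, h3⟩
      refine (oneDist_commutator_le_left _ _).trans ?_
      linarith
    · have := hds u v h3
      refine (oneDist_commutator_le_right _ _).trans ?_
      rw [wordMap_conj, oneDist_conj]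
      linarith

/-- The lengths of `aₙ(w, v)` grow at most like `((3 + √17) / 2) ^ n`. -/
theorem exists_norm_abWord_le {α : Type*} [DecidableEq α] (w v : FreeGroup α) :
    ∃ K : ℝ, 0 < K ∧ ∀ n, ((FreeGroup.lift ![w, v] (abWord n).1).norm : ℝ) ≤
      K * ((3 + √17) / 2) ^ n := by
  set r := (3 + √17) / 2 with hr
  have h17 : √17 ^ 2 = 17 := Real.sq_sqrt (by norm_num)
  have hr2 : r ^ 2 = 3 * r + 2 := by rw [hr]; linear_combination h17 / 4
  have h4 : 4 ≤ √17 := Real.le_sqrt_of_sq_le (by norm_num)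
  have hr3 : 3 ≤ r := by rw [hr]; linarith
  let K : ℝ := w.norm + v.norm + 1
  have hK : 0 < K := by positivity
  have hmul : ∀ x y : FreeGroup α, ((x * y).norm : ℝ) ≤ x.norm + y.norm := fun x y => by
    exact_mod_cast FreeGroup.norm_mul_le x y
  -- With L bounding |a_n|, |b_n| and P bounding |a_n b_n|, the step is (L, P) ↦ (2L+P, 4L+P); (1,
  -- r-2) is its eigenvector for r.
  have key : ∀ n, ((FreeGroup.lift ![w, v] (abWord n).1).norm : ℝ) ≤ K * r ^ n ∧
      ((FreeGroup.lift ![w, v] (abWord n).2).norm : ℝ) ≤ K * r ^ n ∧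
      ((FreeGroup.lift ![w, v] (abWord n).1 * FreeGroup.lift ![w, v] (abWord n).2).norm : ℝ) ≤
        (r - 2) * (K * r ^ n) := by
    intro n
    induction n with
    | zero =>
      have hw : (0 : ℝ) ≤ w.norm := by positivity
      have hv : (0 : ℝ) ≤ v.norm := by positivity
      have := hmul w v
      simp only [abWord, FreeGroup.lift_apply_of, pow_zero, mul_one]
      simp only [Matrix.cons_val_zero, Matrix.cons_val_one]
      refine ⟨by simp only [K]; linarith, by simp only [K]; linarith, ?_⟩
      have : K ≤ (r - 2) * K := le_mul_of_one_le_left hK.le (by linarith)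
      simp only [K] at this ⊢
      linarith
    | succ n ih =>
      rw [(lift_abWord_succ w v n).1, (lift_abWord_succ w v n).2]
      generalize FreeGroup.lift ![w, v] (abWord n).1 = x at ih ⊢
      generalize FreeGroup.lift ![w, v] (abWord n).2 = y at ih ⊢
      obtain ⟨hx, hy, hp⟩ := ih
      have e1 : ⁅y⁻¹, x⁆ = y⁻¹ * (x * y) * x⁻¹ := by rw [commutatorElement_def]; group
      have e2 : ⁅x, y⁆ = (x * y) * x⁻¹ * y⁻¹ := commutatorElement_def x y
      have e3 : ⁅y⁻¹, x⁆ * ⁅x, y⁆ = y⁻¹ * (x * y) * y * x⁻¹ * y⁻¹ := by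
        simp only [commutatorElement_def]; group
      rw [e3, e1, e2]
      have n1 := hmul (y⁻¹ * (x * y)) x⁻¹
      have n2 := hmul y⁻¹ (x * y)
      have n3 := hmul ((x * y) * x⁻¹) y⁻¹
      have n4 := hmul (x * y) x⁻¹
      have n5 := hmul (y⁻¹ * (x * y) * y * x⁻¹) y⁻¹
      have n6 := hmul (y⁻¹ * (x * y) * y) x⁻¹
      have n7 := hmul (y⁻¹ * (x * y)) y
      simp only [FreeGroup.norm_inv_eq] at n1 n2 n3 n4 n5 n6 n7
      have hpow : K * r ^ (n + 1) = r * (K * r ^ n) := by ring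
      have hpow2 : (r - 2) * (r * (K * r ^ n)) = (r + 2) * (K * r ^ n) := by
        linear_combination (K * r ^ n) * hr2
      rw [hpow, hpow2]
      refine ⟨by linarith, by linarith, by linarith⟩
  exact ⟨K, hK, fun n => (key n).1⟩

theorem rpow_growth_exponent :
    ((3 + √17) / 2) ^ (Real.logb 2 (1 + √2) / (Real.logb 2 (3 + √17) - 1)) = 1 + √2 := by
  have h4 : 4 ≤ √17 := Real.le_sqrt_of_sq_le (by norm_num)
  have h2 : Real.log 2 ≠ 0 := (Real.log_pos (by norm_num)).ne'
  have h1 : Real.logb 2 (3 + √17) - 1 = Real.logb 2 ((3 + √17) / 2) := by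
    rw [Real.logb_div (by positivity) (by norm_num), Real.logb_self_eq_one (by norm_num)]
  have h3 : Real.logb 2 (1 + √2) / Real.logb 2 ((3 + √17) / 2) =
      Real.logb ((3 + √17) / 2) (1 + √2) := by
    simp only [Real.logb]
    rw [div_div_div_cancel_right₀ h2]
  rw [h1, h3, Real.rpow_logb (by positivity) (by linarith) (by positivity)]

theorem growth_exponent_pos :
    0 < Real.logb 2 (1 + √2) / (Real.logb 2 (3 + √17) - 1) := by
  have h4 : 4 ≤ √17 := Real.le_sqrt_of_sq_le (by norm_num)
  have h2 : 0 < √2 := Real.sqrt_pos.2 (by norm_num)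
  refine div_pos (Real.logb_pos (by norm_num) (by linarith)) (sub_pos.2 ?_)
  rw [Real.lt_logb_iff_rpow_lt (by norm_num) (by positivity)]
  norm_num
  linarith

end Rates

/-! ### From pointwise distances to L_k, and the main theorem -/

section MaxDist

theorem oneDist_le_maxDist (k : ℕ) (z : F₂) (u v : SU k) :
    oneDist (wordMap z u v) ≤ maxDist k z := (isGreatest_maxDist k z).2 ⟨u, v, rfl⟩

theorem maxDist_le {k : ℕ} {z : F₂} {r : ℝ} (h : ∀ u v : SU k, oneDist (wordMap z u v) ≤ r) :
    maxDist k z ≤ r := by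
  obtain ⟨u, v, huv⟩ := (isGreatest_maxDist k z).1
  rw [huv]
  exact h u v

theorem maxDist_nonneg (k : ℕ) (z : F₂) : 0 ≤ maxDist k z :=
  (oneDist_nonneg _).trans (oneDist_le_maxDist k z 1 1)

theorem maxDist_commutator_le (k : ℕ) (x y : F₂) :
    maxDist k ⁅x, y⁆ ≤ 2 * maxDist k x * maxDist k y := by
  refine maxDist_le fun u v => ?_
  rw [wordMap_commutator]
  refine (oneDist_commutator_le _ _).trans (mul_le_mul ?_ (oneDist_le_maxDist k y u v)
    (oneDist_nonneg _) (mul_nonneg (by norm_num) (maxDist_nonneg k x)))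
  exact mul_le_mul_of_nonneg_left (oneDist_le_maxDist k x u v) (by norm_num)

theorem isAlmostLaw_of_tendsto_maxDist {k : ℕ} {w : ℕ → F₂} (hw : ∀ n, w n ≠ 1)
    (h : Filter.Tendsto (fun n => maxDist k (w n)) Filter.atTop (𝓝 0)) :
    IsAlmostLaw (SU k) w := by
  open scoped Matrix.Norms.L2Operator in
  refine ⟨hw, fun V hV => ?_⟩
  obtain ⟨ε, hε, hV⟩ := Metric.mem_nhds_iff.1 hV
  obtain ⟨m, hm⟩ := Filter.eventually_atTop.1 (h.eventually (gt_mem_nhds hε))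
  refine ⟨m, fun n hn u v => hV ?_⟩
  rw [Metric.mem_ball, dist_comm, Subtype.dist_eq, dist_eq_norm]
  exact (oneDist_le_maxDist k (w n) u v).trans_lt (hm n hn)

end MaxDist

theorem theorem5p2 (k : ℕ) :
    (∀ x y : F₂, maxDist k ⁅x, y⁆ ≤ 2 * maxDist k x * maxDist k y) ∧
    ∃ w v : F₂, Function.Injective (fun z : F₂ => wordMap z w v) ∧
      IsAlmostLaw (SU k) (fun n => wordMap (abWord n).1 w v) ∧
      ∃ C : ℝ, 0 < C ∧ ∀ n : ℕ,
        maxDist k (wordMap (abWord n).1 w v) ≤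
          Real.exp (-C * (FreeGroup.norm (wordMap (abWord n).1 w v) : ℝ) ^
            (Real.logb 2 (1 + √2) / (Real.logb 2 (3 + √17) - 1))) := by
  refine ⟨maxDist_commutator_le k, ?_⟩
  obtain ⟨w, hw, hws⟩ := exists_word_small k (ε := 1 / 8) (by norm_num)
  obtain ⟨g, hg⟩ := FreeGroup.exists_not_commute_conj hw hw
  have hinj := FreeGroup.lift_injective_of_not_commute hg
  have hdist : ∀ n, maxDist k (wordMap (abWord n).1 w (g * w * g⁻¹)) ≤
      (1 / 2 : ℝ) ^ ((1 + √2) ^ n) := fun n => maxDist_le fun x y => by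
    rw [wordMap_wordMap, wordMap_conj]
    have h := (two_mul_oneDist_abWord_le (hws x y)
      ((oneDist_conj (wordMap g x y) _).le.trans (hws x y)) n).1
    have h0 := oneDist_nonneg (wordMap (abWord n).1 (wordMap w x y)
      (wordMap g x y * wordMap w x y * (wordMap g x y)⁻¹))
    unfold wordMap at h h0 ⊢
    linarith
  refine ⟨w, g * w * g⁻¹, hinj, isAlmostLaw_of_tendsto_maxDist (fun n h => ?_) ?_, ?_⟩
  · refine abWord_fst_ne_one n (hinj ?_)
    rw [map_one]; exact h
  · exact squeeze_zero (fun n => maxDist_nonneg k _) hdist tendsto_half_rpow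
  · obtain ⟨K, hK, hlen⟩ := exists_norm_abWord_le w (g * w * g⁻¹)
    have hδ := rpow_growth_exponent
    have hδ0 := growth_exponent_pos
    set δ := Real.logb 2 (1 + √2) / (Real.logb 2 (3 + √17) - 1)
    have hl2 : 0 < Real.log 2 := Real.log_pos (by norm_num)
    have hKδ : 0 < K ^ δ := Real.rpow_pos_of_pos hK δ
    -- Since r^δ = 1+√2, ℓ(w_n)^δ ≤ K^δ (1+√2)ⁿ; this C turns that into the bound 2^(-(1+√2)ⁿ).
    refine ⟨Real.log 2 / K ^ δ, by positivity, fun n => (hdist n).trans ?_⟩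
    rw [Real.rpow_def_of_pos (by norm_num), Real.exp_le_exp, one_div, Real.log_inv, neg_mul,
      neg_mul, neg_le_neg_iff, div_mul_eq_mul_div, div_le_iff₀ hKδ,
      mul_assoc (Real.log 2)]
    refine mul_le_mul_of_nonneg_left ?_ hl2.le
    calc ((wordMap (abWord n).1 w (g * w * g⁻¹)).norm : ℝ) ^ δ
        ≤ (K * ((3 + √17) / 2) ^ n) ^ δ :=
          Real.rpow_le_rpow (by positivity) (hlen n) hδ0.le
      _ = (1 + √2) ^ n * K ^ δ := by
          rw [Real.mul_rpow hK.le (by positivity), ← Real.rpow_natCast,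
            ← Real.rpow_mul (by positivity), mul_comm (n : ℝ), Real.rpow_mul (by positivity),
            hδ, Real.rpow_natCast, mul_comm]
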